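/- Let $R$ be a commutative Noetherian ring, and let $p\ge 1$, $q\ge 3$ be integers. For an ideal $K\subseteq R$ put $\operatorname{grade} K=\inf\{i : \operatorname{Ext}^i_R(R/K,R)\ne 0\}$, so that the unit ideal has grade $\infty$. For a linear map $\varphi$ of finite free modules, $I_k(\varphi)$ is the ideal generated by the $k\times k$ minors of $\varphi$. A complex $0\to F_n\to\cdots\to F_0$ is called acyclic if it is exact except possibly at $F_0$. Let $$\mathbb A\colon\ 0\to A_3\xrightarrow{d_3}A_2\xrightarrow{d_2}A_1\xrightarrow{d_1}A_0=R$$ be an acyclic complex of free $R$-modules with $\operatorname{rank}A_1=p+2$, $\operatorname{rank}A_2=p+q$, $\operatorname{rank}A_3=q-1$ (so $\mathbb A$ resolves $R/I$ with $I=\operatorname{im} d_1$), and suppose that the dual complex $0\to A_0^*\to A_1^*\to A_2^*\to A_3^*$ is acyclic too. Fix a graded-commutative differential graded algebra structure on $\mathbb A$ with unit $1\in A_0=R$, and a decomposition $A_3=C\oplus L$ with $C\cong R^{q-2}$ and $L\cong R$; let $\eta\colon A_3\to L$ be the projection along $C$. For finite free $M$ identify $M^*\otimes L$ with $\operatorname{Hom}(M,L)$,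 and consider $$\mathbb B\colon\ 0\to C\xrightarrow{\delta_4}A_2\xrightarrow{\delta_3}(A_1^*\otimes L)\oplus A_1\xrightarrow{\delta_2}A_2^*\otimes L\xrightarrow{\delta_1}C^*\otimes L,$$ where $\delta_4=d_3|_C$, where $\delta_3(f)=(\eta((-)\cdot f),\,d_2(f))$ for $f\in A_2$, where $\delta_2=\delta_3^*$, that is, $\delta_2(\varphi,e)(f)=\varphi(d_2f)+\eta(e\cdot f)$, and where $\delta_1=\delta_4^*$, that is, $\delta_1(\psi)=\psi\circ\delta_4$. Then $\mathbb B$ is a complex, and it is self-dual up to the twist by $L$: the evaluation maps $C\to\operatorname{Hom}(\operatorname{Hom}(C,L),L)$ and $A_2\to\operatorname{Hom}(\operatorname{Hom}(A_2,L),L)$, the map $(A_1^*\otimes L)\oplus A_1\to\operatorname{Hom}((A_1^*\otimes L)\oplus A_1,L)$ given by the pairing $\langle(\varphi,e),(\psi,e')\rangle=\psi(e)+\varphi(e')$, and the identity maps of $A_2^*\otimes L$ and $C^*\otimes L$ form an isomorphism of complexes $\mathbb B\to\operatorname{Hom}(\mathbb B,L)$. Moreover, let $J=I_{q-2}(\delta_4)$.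 If $\operatorname{grade}J\ge 4$, then $\mathbb B$ is acyclic, and either $\operatorname{grade}J=4$ or $J=(1)$. -/

import Mathlib

universe u v

/-- `M` is a free `R`-module of rank `n`, i.e. `M ≅ R ^ n`. -/
def IsFreeOfRank (R : Type*) [CommRing R] (M : Type*) [AddCommGroup M] [Module R M]
    (n : ℕ) : Prop :=
  Nonempty (Module.Basis (Fin n) R M)

/-- The grade of a module: `grade M = inf {i | Ext^i(M, R) ≠ 0}`, with `inf ∅ = ∞`. -/
noncomputable def moduleGrade (R : Type u) [CommRing R] (M : Type u) [AddCommGroup M]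
    [Module R M] : ℕ∞ :=
  sInf {n : ℕ∞ | ∃ i : ℕ, n = (i : ℕ∞) ∧
    Nontrivial (CategoryTheory.Abelian.Ext (ModuleCat.of R M) (ModuleCat.of R R) i)}

/-- The grade of an ideal `I` is the grade of the module `R ⧸ I`. -/
noncomputable def idealGrade {R : Type u} [CommRing R] (I : Ideal R) : ℕ∞ :=
  moduleGrade R (R ⧸ I)

section Minors

variable {R : Type*} [CommRing R] {M N : Type*} [AddCommGroup M] [Module R M]
  [AddCommGroup N] [Module R N]

/-- The ideal `I_k(φ)` of `k × k` minors of a linear map `φ : M → N` of free modules, written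
without bases: it is generated by the determinants `det (ψ_i (φ (x_j)))` with `x_j ∈ M` and
`ψ_i ∈ N^*`, i.e. it is the image of `⋀^k M ⊗ ⋀^k N^* → R`. See `minorsIdeal_eq_span_minors` for
the description by a matrix of `φ`. -/
def minorsIdeal (k : ℕ) (φ : M →ₗ[R] N) : Ideal R :=
  Ideal.span {a : R | ∃ (x : Fin k → M) (ψ : Fin k → Module.Dual R N),
    a = (Matrix.of fun i j => ψ i (φ (x j))).det}

theorem det_mul_mem {m : Type*} [Fintype m] {k : ℕ} (I : Ideal R)
    (P : Matrix (Fin k) m R) (X : Matrix m (Fin k) R)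
    (h : ∀ r : Fin k → m, (X.submatrix r id).det ∈ I) : (P * X).det ∈ I := by
  have : (P * X).det = ∑ r : Fin k → m, (∏ i, P i (r i)) * (X.submatrix r id).det := by
    have h1 : (P * X) = fun i => ∑ a, P i a • X a := by
      ext i j
      simp [Matrix.mul_apply]
    rw [h1]
    change Matrix.detRowAlternating (fun i => ∑ a, P i a • X a) = _
    classical
    rw [← AlternatingMap.coe_multilinearMap, MultilinearMap.map_sum]
    refine Finset.sum_congr rfl fun r _ => ?_
    rw [MultilinearMap.map_smul_univ]
    rfl
  rw [this]
  exact Ideal.sum_mem _ fun r _ => Ideal.mul_mem_left _ _ (h r)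

/-- In terms of bases, `I_k(φ)` is the ideal of `k × k` minors of the matrix of `φ`. -/
theorem minorsIdeal_eq_span_minors {m n : Type*} [Fintype m] [Fintype n] [DecidableEq n]
    (b : Module.Basis n R M) (c : Module.Basis m R N) (k : ℕ) (φ : M →ₗ[R] N) :
    minorsIdeal k φ = Ideal.span {a : R | ∃ (r : Fin k → m) (s : Fin k → n),
      a = ((LinearMap.toMatrix b c φ).submatrix r s).det} := by
  apply le_antisymm
  · refine Ideal.span_le.2 ?_
    rintro a ⟨x, ψ, rfl⟩
    have key : (Matrix.of fun i j => ψ i (φ (x j))) =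
        (Matrix.of fun i a => ψ i (c a)) * (LinearMap.toMatrix b c φ *
          (Matrix.of fun a j => b.repr (x j) a)) := by
      ext i j
      have h1 : φ (x j) = ∑ a, (LinearMap.toMatrix b c φ *
          (Matrix.of fun a j => b.repr (x j) a)) a j • c a := by
        conv_lhs => rw [← c.sum_repr (φ (x j))]
        refine Finset.sum_congr rfl fun a _ => ?_
        congr 1
        rw [← LinearMap.toMatrix_mulVec_repr b c φ (x j)]
        rfl
      simp only [Matrix.of_apply]
      rw [h1, map_sum, Matrix.mul_apply]
      refine Finset.sum_congr rfl fun a _ => ?_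
      rw [map_smul, smul_eq_mul, mul_comm]
      rfl
    rw [SetLike.mem_coe, key]
    refine det_mul_mem _ _ _ fun r => ?_
    rw [← Matrix.det_transpose, Matrix.transpose_submatrix, Matrix.transpose_mul]
    have : ((Matrix.of fun a j => b.repr (x j) a).transpose *
        (LinearMap.toMatrix b c φ).transpose).submatrix id r =
        (Matrix.of fun a j => b.repr (x j) a).transpose *
        ((LinearMap.toMatrix b c φ).transpose.submatrix id r) := rfl
    rw [this]
    refine det_mul_mem _ _ _ fun s => Ideal.subset_span ⟨r, s, ?_⟩
    rw [← Matrix.det_transpose]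
    rfl
  · refine Ideal.span_le.2 ?_
    rintro a ⟨r, s, rfl⟩
    refine Ideal.subset_span ⟨fun j => b (s j), fun i => c.coord (r i), ?_⟩
    congr 1
    ext i j
    simp [LinearMap.toMatrix_apply]

end Minors

section Complexes

variable {R : Type*} [CommRing R]
  {F₀ F₁ F₂ F₃ F₄ : Type*}
  [AddCommGroup F₀] [Module R F₀] [AddCommGroup F₁] [Module R F₁]
  [AddCommGroup F₂] [Module R F₂] [AddCommGroup F₃] [Module R F₃]
  [AddCommGroup F₄] [Module R F₄]

/-- `0 → F₃ → F₂ → F₁ → F₀` is an acyclic complex, i.e. exact except possibly at `F₀`. -/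
def IsAcyclicThree (d₃ : F₃ →ₗ[R] F₂) (d₂ : F₂ →ₗ[R] F₁) (d₁ : F₁ →ₗ[R] F₀) : Prop :=
  Function.Injective d₃ ∧ Function.Exact d₃ d₂ ∧ Function.Exact d₂ d₁

/-- `0 → F₄ → F₃ → F₂ → F₁ → F₀` is a complex. -/
def IsComplexFour (δ₄ : F₄ →ₗ[R] F₃) (δ₃ : F₃ →ₗ[R] F₂) (δ₂ : F₂ →ₗ[R] F₁)
    (δ₁ : F₁ →ₗ[R] F₀) : Prop :=
  δ₃ ∘ₗ δ₄ = 0 ∧ δ₂ ∘ₗ δ₃ = 0 ∧ δ₁ ∘ₗ δ₂ = 0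

/-- `0 → F₄ → F₃ → F₂ → F₁ → F₀` is an acyclic complex, i.e. exact except possibly at `F₀`. -/
def IsAcyclicFour (δ₄ : F₄ →ₗ[R] F₃) (δ₃ : F₃ →ₗ[R] F₂) (δ₂ : F₂ →ₗ[R] F₁)
    (δ₁ : F₁ →ₗ[R] F₀) : Prop :=
  Function.Injective δ₄ ∧ Function.Exact δ₄ δ₃ ∧ Function.Exact δ₃ δ₂ ∧ Function.Exact δ₂ δ₁

end Complexes

section DGAlgebra

variable {R : Type*} [CommRing R] {A₁ A₂ A₃ : Type*}
  [AddCommGroup A₁] [Module R A₁] [AddCommGroup A₂] [Module R A₂]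
  [AddCommGroup A₃] [Module R A₃]

/-- A graded-commutative DG-algebra structure, with unit `1 ∈ A₀ = R`, on a complex
`0 → A₃ → A₂ → A₁ → R`. Products with `A₀` are scalar multiplications, `f · e = e · f` for
`e ∈ A₁`, `f ∈ A₂`, and all products of total degree `≥ 4` vanish. The remaining laws
(the Leibniz rule in total degree 4 and associativity) are automatic when `d₃` is injective:
see the lemmas below. -/
structure DGAStructure (d₃ : A₃ →ₗ[R] A₂) (d₂ : A₂ →ₗ[R] A₁) (d₁ : A₁ →ₗ[R] R) where
  /-- the product `A₁ ⊗ A₁ → A₂` -/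
  mul₁₁ : A₁ →ₗ[R] A₁ →ₗ[R] A₂
  /-- the product `A₁ ⊗ A₂ → A₃` -/
  mul₁₂ : A₁ →ₗ[R] A₂ →ₗ[R] A₃
  comm₁₁ : ∀ e e' : A₁, mul₁₁ e e' = -mul₁₁ e' e
  leibniz₁₁ : ∀ e e' : A₁, d₂ (mul₁₁ e e') = d₁ e • e' - d₁ e' • e
  leibniz₁₂ : ∀ (e : A₁) (f : A₂), d₃ (mul₁₂ e f) = d₁ e • f - mul₁₁ e (d₂ f)

namespace DGAStructure

variable {d₃ : A₃ →ₗ[R] A₂} {d₂ : A₂ →ₗ[R] A₁} {d₁ : A₁ →ₗ[R] R}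

theorem leibniz₁₃ (μ : DGAStructure d₃ d₂ d₁) (h₃ : Function.Injective d₃)
    (h : ∀ g, d₂ (d₃ g) = 0) (e : A₁) (g : A₃) : d₁ e • g - μ.mul₁₂ e (d₃ g) = 0 := by
  apply h₃
  simp [μ.leibniz₁₂, h]

theorem leibniz₂₂ (μ : DGAStructure d₃ d₂ d₁) (h₃ : Function.Injective d₃)
    (h : ∀ f, d₁ (d₂ f) = 0) (f f' : A₂) :
    μ.mul₁₂ (d₂ f) f' + μ.mul₁₂ (d₂ f') f = 0 := by
  apply h₃
  rw [map_add, μ.leibniz₁₂, μ.leibniz₁₂, μ.comm₁₁ (d₂ f) (d₂ f')]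
  simp [h]

theorem assoc (μ : DGAStructure d₃ d₂ d₁) (h₃ : Function.Injective d₃) (e e' e'' : A₁) :
    μ.mul₁₂ e (μ.mul₁₁ e' e'') = μ.mul₁₂ e'' (μ.mul₁₁ e e') := by
  apply h₃
  simp only [μ.leibniz₁₂, μ.leibniz₁₁, map_sub, map_smul]
  rw [μ.comm₁₁ e'' e', μ.comm₁₁ e'' e]
  module

end DGAStructure

end DGAlgebra

section TwistedDuality

variable {R : Type*} [CommRing R]

/-- The dual of `φ : M → N` twisted by `L`, i.e. the map
`N^* ⊗ L = Hom(N, L) → Hom(M, L) = M^* ⊗ L`, `ψ ↦ ψ ∘ φ`. -/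
def twistedDual {M N : Type*} [AddCommGroup M] [Module R M] [AddCommGroup N] [Module R N]
    (L : Type*) [AddCommGroup L] [Module R L] (φ : M →ₗ[R] N) :
    (N →ₗ[R] L) →ₗ[R] (M →ₗ[R] L) :=
  LinearMap.lcomp R L φ

/-- The evident symmetric `L`-valued pairing on `Hom(H, L) ⊕ H`,
`⟨(φ, e), (ψ, e')⟩ = ψ e + φ e'`, viewed as a map `Hom(H, L) ⊕ H → Hom(Hom(H, L) ⊕ H, L)`. -/
def hyperbolicPairing (R : Type*) [CommRing R] (H L : Type*) [AddCommGroup H] [Module R H]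
    [AddCommGroup L] [Module R L] :
    ((H →ₗ[R] L) × H) →ₗ[R] (((H →ₗ[R] L) × H) →ₗ[R] L) :=
  LinearMap.mk₂ R (fun x y => y.1 x.2 + x.1 y.2)
    (fun x x' y => by simp; abel) (fun a x y => by simp)
    (fun x y y' => by simp; abel) (fun a x y => by simp)

/-- The complex `F₄ → F₃ → F₂ → Hom(F₃, L) → Hom(F₄, L)` is self-dual up to the twist by `L`,
through `θ : F₂ → Hom(F₂, L)`: the evaluation maps `F₄ → Hom(Hom(F₄, L), L)` and
`F₃ → Hom(Hom(F₃, L), L)`, the map `θ` and two identity maps are the components of an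
isomorphism from the complex to its `L`-twisted dual. -/
def IsSelfDualFour {F₄ F₃ F₂ L : Type*} [AddCommGroup F₄] [Module R F₄]
    [AddCommGroup F₃] [Module R F₃] [AddCommGroup F₂] [Module R F₂] [AddCommGroup L] [Module R L]
    (θ : F₂ →ₗ[R] (F₂ →ₗ[R] L))
    (δ₄ : F₄ →ₗ[R] F₃) (δ₃ : F₃ →ₗ[R] F₂) (δ₂ : F₂ →ₗ[R] (F₃ →ₗ[R] L))
    (δ₁ : (F₃ →ₗ[R] L) →ₗ[R] (F₄ →ₗ[R] L)) : Prop :=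
  Function.Bijective (LinearMap.applyₗ : F₄ →ₗ[R] (F₄ →ₗ[R] L) →ₗ[R] L) ∧
  Function.Bijective (LinearMap.applyₗ : F₃ →ₗ[R] (F₃ →ₗ[R] L) →ₗ[R] L) ∧
  Function.Bijective θ ∧
  twistedDual L δ₁ ∘ₗ (LinearMap.applyₗ : F₄ →ₗ[R] (F₄ →ₗ[R] L) →ₗ[R] L) =
    (LinearMap.applyₗ : F₃ →ₗ[R] (F₃ →ₗ[R] L) →ₗ[R] L) ∘ₗ δ₄ ∧
  twistedDual L δ₂ ∘ₗ (LinearMap.applyₗ : F₃ →ₗ[R] (F₃ →ₗ[R] L) →ₗ[R] L) = θ ∘ₗ δ₃ ∧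
  twistedDual L δ₃ ∘ₗ θ = δ₂ ∧
  twistedDual L δ₄ = δ₁

end TwistedDuality

section Construction

variable {R : Type*} [CommRing R] {A₁ A₂ A₃ : Type*}
  [AddCommGroup A₁] [Module R A₁] [AddCommGroup A₂] [Module R A₂]
  [AddCommGroup A₃] [Module R A₃]
  {d₃ : A₃ →ₗ[R] A₂} {d₂ : A₂ →ₗ[R] A₁} {d₁ : A₁ →ₗ[R] R}

/-- `δ₄ : C → A₂`, the restriction of `d₃` to `C ⊆ A₃`. -/
def deltaFour (d₃ : A₃ →ₗ[R] A₂) (C : Submodule R A₃) : C →ₗ[R] A₂ :=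
  d₃ ∘ₗ C.subtype

/-- The projection `η : A₃ = C ⊕ L → L`. -/
noncomputable def etaProj {C L : Submodule R A₃} (hCL : IsCompl C L) : A₃ →ₗ[R] L :=
  L.projectionOnto C hCL.symm

/-- `δ₃ : A₂ → Hom(A₁, L) ⊕ A₁`, `δ₃ f = (η((-) · f), d₂ f)`. -/
noncomputable def deltaThree (μ : DGAStructure d₃ d₂ d₁) {C L : Submodule R A₃}
    (hCL : IsCompl C L) : A₂ →ₗ[R] (A₁ →ₗ[R] L) × A₁ :=
  LinearMap.prod (μ.mul₁₂.compr₂ (etaProj hCL)).flip d₂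

/-- `δ₂ = δ₃^* : Hom(A₁, L) ⊕ A₁ → Hom(A₂, L)`, the `L`-twisted dual of `δ₃`, where
`Hom(A₁, L) ⊕ A₁` is identified with its own `L`-twisted dual by the evident pairing. -/
noncomputable def deltaTwo (μ : DGAStructure d₃ d₂ d₁) {C L : Submodule R A₃}
    (hCL : IsCompl C L) : ((A₁ →ₗ[R] L) × A₁) →ₗ[R] (A₂ →ₗ[R] L) :=
  twistedDual L (deltaThree μ hCL) ∘ₗ hyperbolicPairing R A₁ L

/-- `δ₁ = δ₄^* : Hom(A₂, L) → Hom(C, L)`, the `L`-twisted dual of `δ₄`. -/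
noncomputable def deltaOne (d₃ : A₃ →ₗ[R] A₂) (C L : Submodule R A₃) :
    (A₂ →ₗ[R] L) →ₗ[R] (C →ₗ[R] L) :=
  twistedDual L (deltaFour d₃ C)

end Construction

/-! Everything rests on `e · d₃ g = d₁ e • g`, the Leibniz rule for a product that lands in degree
4. It makes `𝔹` a complex and turns exactness at `A₂` and at the middle term into statements about
`𝔸` and its dual (`exact_deltaFour_deltaThree`, `exact_deltaThree_deltaTwo`). At `Hom(A₂, L)`, a `ψ`
killed by `δ₁` satisfies `ψ ∘ d₃ = x • η`. If `x = d₁ e`, then `ψ - η(e · -)` vanishes on the image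
of `d₃`, hence factors through `d₂`, and `ψ` is in the image of `δ₂`. To see that `x ∈ I`, take `a ∈
J`: Cramer's rule makes `a x` on `A₃` factor through `d₃`, so `a x` is null-homotopic on `𝔸` and
lies in `I` (`smul_mem_range_of_mem_minorsIdeal`). Since `R/I` has a free resolution of length 3 and
`grade J ≥ 4`, it has no `J`-torsion. If `grade J ≥ 5`, the same argument along `𝔹` shows that coker
`δ₁` has no `J`-torsion. But `J` annihilates it, so `δ₁` is onto, `δ₄` splits and `J = R`. -/

/-! ### Reflexivity with respect to `L` and the hyperbolic pairing. -/

section Evaluation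

variable {R : Type*} [CommRing R] {M L : Type*} [AddCommGroup M] [Module R M]
  [AddCommGroup L] [Module R L]

/-- A finite free module is reflexive with respect to a free module of rank one. -/
theorem bijective_applyₗ_of_basis {n : ℕ} (b : Module.Basis (Fin n) R M) (e : L ≃ₗ[R] R) :
    Function.Bijective (LinearMap.applyₗ : M →ₗ[R] (M →ₗ[R] L) →ₗ[R] L) := by
  have := Module.Free.of_basis b
  have := Module.Finite.of_basis b
  constructor
  · intro x y h
    apply (Module.evalEquiv R M).injective
    ext f
    have := LinearMap.congr_fun h (e.symm.toLinearMap ∘ₗ f)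
    simpa using this
  · intro Φ
    -- Through `L ≅ R`, `Φ` becomes an element of the double dual of `M`.
    refine ⟨(Module.evalEquiv R M).symm
      (e.toLinearMap ∘ₗ Φ ∘ₗ LinearMap.llcomp R M R L e.symm.toLinearMap), ?_⟩
    ext φ
    apply e.injective
    have h := LinearMap.congr_fun ((Module.evalEquiv R M).apply_symm_apply
      (e.toLinearMap ∘ₗ Φ ∘ₗ LinearMap.llcomp R M R L e.symm.toLinearMap))
      (e.toLinearMap ∘ₗ φ)
    rw [Module.evalEquiv_apply] at h
    simp only [Module.Dual.eval_apply, LinearMap.comp_apply, LinearEquiv.coe_coe] at h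
    rw [LinearMap.applyₗ_apply_apply, h]
    congr 2
    ext x
    simp

/-- A functional on the product is a pair: its restriction to `M` is the first coordinate, and its
restriction to `Hom(M, L)` is evaluation at a unique element by reflexivity. -/
theorem bijective_hyperbolicPairing
    (h : Function.Bijective (LinearMap.applyₗ : M →ₗ[R] (M →ₗ[R] L) →ₗ[R] L)) :
    Function.Bijective (hyperbolicPairing R M L) := by
  constructor
  · rintro ⟨φ, x⟩ ⟨ψ, y⟩ hxy
    have h1 : φ = ψ := by
      ext z
      simpa [hyperbolicPairing] using LinearMap.congr_fun hxy (0, z)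
    have h2 : x = y := by
      apply h.1
      ext χ
      simpa [hyperbolicPairing] using LinearMap.congr_fun hxy (χ, 0)
    rw [h1, h2]
  · intro Φ
    obtain ⟨x, hx⟩ := h.2 (Φ ∘ₗ LinearMap.inl R _ _)
    refine ⟨(Φ ∘ₗ LinearMap.inr R _ _, x), ?_⟩
    refine LinearMap.ext fun y => ?_
    have h1 : y.1 x = Φ (y.1, 0) := LinearMap.congr_fun hx y.1
    change y.1 x + Φ (0, y.2) = Φ y
    rw [h1, ← map_add]
    simp

end Evaluation

/-! ### Factoring maps by exactness of the dual. -/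

section Homotopy

variable {R : Type*} [CommRing R] {M N P : Type*} [AddCommGroup M] [Module R M]
  [AddCommGroup N] [Module R N] [AddCommGroup P] [Module R P]

/-- If every functional in the kernel of `f^*` factors through `g`, then so does every map to a
finite free module that vanishes on the image of `f`. -/
theorem exists_comp_eq_of_dual_exact {Q : Type*} [AddCommGroup Q] [Module R Q] {n : ℕ}
    (b : Module.Basis (Fin n) R Q) {f : M →ₗ[R] N} {g : N →ₗ[R] P}
    (h : Function.Exact g.dualMap f.dualMap) (k : N →ₗ[R] Q) (hk : k ∘ₗ f = 0) :
    ∃ s : P →ₗ[R] Q, s ∘ₗ g = k := by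
  have h1 : ∀ i, ∃ t : P →ₗ[R] R, t ∘ₗ g = b.coord i ∘ₗ k := fun i =>
    (h (b.coord i ∘ₗ k)).1 <| by
      change (b.coord i ∘ₗ k) ∘ₗ f = 0
      rw [LinearMap.comp_assoc, hk, LinearMap.comp_zero]
  choose t ht using h1
  refine ⟨∑ i, (t i).smulRight (b i), ?_⟩
  ext x
  conv_rhs => rw [← b.sum_repr (k x)]
  simp only [LinearMap.comp_apply, LinearMap.sum_apply, LinearMap.smulRight_apply]
  refine Finset.sum_congr rfl fun i _ => ?_
  congr 1
  exact LinearMap.congr_fun (ht i) x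

end Homotopy

/-! ### Maximal minors and left inverses. -/

section Minors

variable {R : Type*} [CommRing R] {M N : Type*} [AddCommGroup M] [Module R M]
  [AddCommGroup N] [Module R N]

/-- Cramer rule: for every element `a` of the ideal of maximal minors of `φ`, multiplication by `a`
on the source factors through `φ`. -/
theorem exists_comp_eq_smul_of_mem_minorsIdeal {n : ℕ} (b : Module.Basis (Fin n) R M)
    (φ : M →ₗ[R] N) {a : R} (ha : a ∈ minorsIdeal n φ) :
    ∃ σ : N →ₗ[R] M, σ ∘ₗ φ = a • LinearMap.id := by
  refine Submodule.span_induction (p := fun a _ => ∃ σ : N →ₗ[R] M, σ ∘ₗ φ = a • LinearMap.id)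
    ?_ ⟨0, by simp⟩ ?_ ?_ ha
  · rintro _ ⟨x, ψ, rfl⟩
    -- `x = T b`, so the matrix `(ψ_i (φ (x_j)))` is the product of `(ψ_i (φ (b_j)))` and `T`
    let A : Matrix (Fin n) (Fin n) R := Matrix.of fun i j => ψ i (φ (b j))
    let T : Matrix (Fin n) (Fin n) R := Matrix.of fun i j => b.repr (x j) i
    have hAT : (Matrix.of fun i j => ψ i (φ (x j))) = A * T := by
      ext i j
      simp only [Matrix.of_apply, Matrix.mul_apply, A, T]
      conv_lhs => rw [← b.sum_repr (x j)]
      simp only [map_sum, map_smul, smul_eq_mul, mul_comm]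
    rw [hAT, Matrix.det_mul]
    -- The coordinates of `σ` are `det T` times the adjugate of `A` applied to the `ψ_j`; then `adj
    -- A * A = det A` gives the scalar.
    refine ⟨T.det • ∑ i, (∑ j, A.adjugate i j • ψ j).smulRight (b i), ?_⟩
    refine b.ext fun k => ?_
    have hk : ∀ i, ∑ j, A.adjugate i j * ψ j (φ (b k)) = if i = k then A.det else 0 := by
      intro i
      have := congrFun (congrFun A.adjugate_mul i) k
      simpa [Matrix.mul_apply, A, Matrix.one_apply] using this
    simp [hk, smul_smul, mul_comm A.det]
  · rintro a c - - ⟨σ, hσ⟩ ⟨τ, hτ⟩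
    exact ⟨σ + τ, by rw [LinearMap.add_comp, hσ, hτ, add_smul]⟩
  · rintro r a - ⟨σ, hσ⟩
    exact ⟨r • σ, by rw [LinearMap.smul_comp, hσ, smul_smul, smul_eq_mul]⟩

theorem minorsIdeal_eq_top_of_comp_eq_id {n : ℕ} (b : Module.Basis (Fin n) R M)
    (φ : M →ₗ[R] N) (σ : N →ₗ[R] M) (h : σ ∘ₗ φ = LinearMap.id) : minorsIdeal n φ = ⊤ := by
  rw [Ideal.eq_top_iff_one]
  refine Ideal.subset_span ⟨b, fun i => b.coord i ∘ₗ σ, ?_⟩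
  have hσ : ∀ x, σ (φ x) = x := fun x => LinearMap.congr_fun h x
  have : (Matrix.of fun i j => (b.coord i ∘ₗ σ) (φ (b j))) = 1 := by
    ext i j
    simp [hσ, Matrix.one_apply, Finsupp.single_apply, eq_comm]
  rw [this, Matrix.det_one]

end Minors

/-! ### Vanishing of Ext and dimension shifting. -/

section GradeOnModules

open CategoryTheory Abelian

variable {R : Type u} [CommRing R]

/-- The ideal `J` has grade at least `k` on `M`: up to isomorphism, `M` is a module `M'` in the
universe of `R` with `Ext^i(R ⧸ J, M') = 0` for all `i < k`. -/
def ExtVanishesBelow (J : Ideal R) (k : ℕ) (M : Type*) [AddCommGroup M] [Module R M] : Prop :=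
  ∃ M' : ModuleCat.{u} R, Nonempty (M ≃ₗ[R] M') ∧
    ∀ i < k, Subsingleton (Ext (ModuleCat.of R (R ⧸ J)) M' i)

variable {J : Ideal R}
  {M N P : Type*} [AddCommGroup M] [Module R M] [AddCommGroup N] [Module R N]
  [AddCommGroup P] [Module R P]

theorem ExtVanishesBelow.mono {k l : ℕ} (h : ExtVanishesBelow J l M) (hkl : k ≤ l) :
    ExtVanishesBelow J k M := by
  obtain ⟨M', e, h⟩ := h
  exact ⟨M', e, fun i hi => h i (hi.trans_le hkl)⟩

/-- The grade of an ideal bounds its grade on every finite free module. -/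
theorem extVanishesBelow_of_free [Module.Free R M] [Module.Finite R M] {k : ℕ}
    (h : (k : ℕ∞) ≤ idealGrade J) : ExtVanishesBelow J k M := by
  obtain ⟨n, ⟨b⟩⟩ : ∃ n : ℕ, Nonempty (Module.Basis (Fin n) R M) :=
    ⟨_, ⟨(Module.Free.chooseBasis R M).reindex (Fintype.equivFin _)⟩⟩
  refine ⟨ModuleCat.of R (Fin n → R), ⟨b.equivFun⟩, fun i hi => ?_⟩
  have hR : Subsingleton (Ext (ModuleCat.of R (R ⧸ J)) (ModuleCat.of R R) i) := by
    by_contra hcon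
    rw [not_subsingleton_iff_nontrivial] at hcon
    have h1 : idealGrade J ≤ i := sInf_le ⟨i, rfl, hcon⟩
    exact absurd (Nat.cast_le.1 (h.trans h1)) (not_le.2 hi)
  refine subsingleton_of_forall_eq 0 fun x => ?_
  -- Decomposing the identity of `R ^ n` writes each class as a sum of classes that pass through
  -- `Ext^i(R ⧸ J, R) = 0`.
  have hid : 𝟙 (ModuleCat.of R (Fin n → R)) =
      ∑ j : Fin n, ModuleCat.ofHom (LinearMap.proj j : (Fin n → R) →ₗ[R] R) ≫
        ModuleCat.ofHom (LinearMap.single R (fun _ => R) j) := by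
    ext x
    simp [ModuleCat.hom_sum]
  rw [← Ext.comp_mk₀_id x, hid, Ext.mk₀_sum, Ext.comp_sum]
  refine Finset.sum_eq_zero fun j _ => ?_
  rw [← Ext.mk₀_comp_mk₀, ← Ext.comp_assoc_of_second_deg_zero,
    Subsingleton.elim (x.comp (Ext.mk₀ (ModuleCat.ofHom (LinearMap.proj j))) (add_zero i)) 0,
    Ext.zero_comp]

/-- In the long exact sequence, `Ext^i(R ⧸ J, P)` sits between `Ext^i(R ⧸ J, N)` and `Ext^(i+1)(R ⧸
J, M)`. -/
theorem ExtVanishesBelow.of_exact {k : ℕ} {f : M →ₗ[R] N} {g : N →ₗ[R] P}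
    (hM : ExtVanishesBelow J (k + 1) M) (hN : ExtVanishesBelow J k N)
    (hf : Function.Injective f) (hfg : Function.Exact f g) (hg : Function.Surjective g) :
    ExtVanishesBelow J k P := by
  obtain ⟨M', ⟨eM⟩, hM⟩ := hM
  obtain ⟨N', ⟨eN⟩, hN⟩ := hN
  let f' : M' →ₗ[R] N' := eN.toLinearMap ∘ₗ f ∘ₗ eM.symm.toLinearMap
  have hf' : Function.Injective f' :=
    eN.injective.comp (hf.comp eM.symm.injective)
  have hmap : (LinearMap.range f).map eN.toLinearMap = LinearMap.range f' := by
    rw [← LinearMap.range_comp]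
    exact (LinearMap.range_comp_of_range_eq_top (eN.toLinearMap ∘ₗ f)
      (LinearEquiv.range eM.symm)).symm
  -- A copy of `P` in the universe of `R`, where Ext is taken.
  let e : P ≃ₗ[R] N' ⧸ LinearMap.range f' :=
    (hfg.linearEquivOfSurjective hg).symm.trans (Submodule.Quotient.equiv _ _ eN hmap)
  let S : ShortComplex (ModuleCat.{u} R) := ShortComplex.mk (ModuleCat.ofHom f')
    (ModuleCat.ofHom (LinearMap.range f').mkQ) (by ext; simp)
  have hS : S.ShortExact :=
    { exact := (ShortComplex.ShortExact.moduleCat_exact_iff_function_exact S).2 <| by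
        intro y
        exact (Submodule.Quotient.mk_eq_zero _)
      mono_f := (ModuleCat.mono_iff_injective _).2 hf'
      epi_g := (ModuleCat.epi_iff_surjective _).2 (Submodule.mkQ_surjective _) }
  refine ⟨ModuleCat.of R (N' ⧸ LinearMap.range f'), ⟨e⟩, fun i hi => ?_⟩
  refine subsingleton_of_forall_eq 0 fun x => ?_
  have h1 := hM (i + 1) (by omega)
  have h2 := hN i hi
  obtain ⟨y, hy⟩ := Ext.covariant_sequence_exact₃ _ hS x rfl
    (@Subsingleton.elim _ h1 _ _)
  rw [← hy, @Subsingleton.elim _ h2 y 0, Ext.zero_comp]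

/-- An element killed by `J` is a map `R ⧸ J → M`, that is, a class in `Ext^0`. -/
theorem ExtVanishesBelow.eq_zero {x : M} (hM : ExtVanishesBelow J 1 M)
    (hx : ∀ a ∈ J, a • x = 0) : x = 0 := by
  obtain ⟨M', ⟨e⟩, hM⟩ := hM
  have h0 := hM 0 one_pos
  let φ : (R ⧸ J) →ₗ[R] M' := J.liftQ (LinearMap.toSpanSingleton R M' (e x)) fun a ha => by
    rw [LinearMap.mem_ker, LinearMap.toSpanSingleton_apply, ← map_smul, hx a ha, map_zero]
  have h1 : ModuleCat.ofHom φ = 0 :=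
    (Ext.mk₀_eq_zero_iff _).1 (@Subsingleton.elim _ h0 _ _)
  have h2 : φ (Submodule.Quotient.mk 1) = 0 := by
    have : φ = 0 := by simpa using congrArg ModuleCat.Hom.hom h1
    rw [this, LinearMap.zero_apply]
  have h3 : φ (Submodule.Quotient.mk 1) = e x :=
    (Submodule.liftQ_apply _ _ _).trans (one_smul R (e x))
  exact e.map_eq_zero_iff.1 (h3.symm.trans h2)

/-- One step of dimension shifting along a free resolution. -/
theorem ExtVanishesBelow.range_of_exact {k : ℕ} {K : Submodule R N} {g : N →ₗ[R] P}
    (hK : ExtVanishesBelow J (k + 1) K) (hN : ExtVanishesBelow J k N)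
    (hg : LinearMap.ker g = K) : ExtVanishesBelow J k (LinearMap.range g) := by
  refine ExtVanishesBelow.of_exact (f := K.subtype) (g := g.rangeRestrict) hK hN
    K.injective_subtype ?_ g.surjective_rangeRestrict
  rw [LinearMap.exact_iff, LinearMap.ker_rangeRestrict, hg, Submodule.range_subtype]

theorem ExtVanishesBelow.range_of_injective {k : ℕ} {g : M →ₗ[R] N}
    (hM : ExtVanishesBelow J k M) (hg : Function.Injective g) :
    ExtVanishesBelow J k (LinearMap.range g) := by
  obtain ⟨M', ⟨e⟩, h⟩ := hM
  exact ⟨M', ⟨(LinearEquiv.ofInjective g hg).symm.trans e⟩, h⟩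

/-- `Hom(R ⧸ J, N ⧸ K)` sits between `Hom(R ⧸ J, N)` and `Ext^1(R ⧸ J, K)`, so `N ⧸ K` has no
`J`-torsion. -/
theorem ExtVanishesBelow.mem_of_forall_smul_mem {K : Submodule R N}
    (hK : ExtVanishesBelow J 2 K) (hN : ExtVanishesBelow J 1 N) {x : N}
    (hx : ∀ a ∈ J, a • x ∈ K) : x ∈ K := by
  have h : ExtVanishesBelow J 1 (N ⧸ K) :=
    ExtVanishesBelow.of_exact hK hN K.injective_subtype
      (LinearMap.exact_subtype_mkQ K) K.mkQ_surjective
  rw [← Submodule.Quotient.mk_eq_zero]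
  refine h.eq_zero fun a ha => ?_
  rw [← Submodule.Quotient.mk_smul, Submodule.Quotient.mk_eq_zero]
  exact hx a ha

end GradeOnModules

/-! ### The complex `𝔹`: self-duality and exactness without the grade hypothesis. -/

section Construction

variable {R : Type*} [CommRing R] {A₁ A₂ A₃ : Type*}
  [AddCommGroup A₁] [Module R A₁] [AddCommGroup A₂] [Module R A₂]
  [AddCommGroup A₃] [Module R A₃]
  {d₃ : A₃ →ₗ[R] A₂} {d₂ : A₂ →ₗ[R] A₁} {d₁ : A₁ →ₗ[R] R}

/-- If the dual complex is acyclic and multiplication by `y` on `A₃` factors through `d₃`, then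
multiplication by `y` is null-homotopic, hence `y` lies in the image of `d₁`. -/
theorem exists_eq_of_comp_eq_smul {n₁ n₂ : ℕ} (b₁ : Module.Basis (Fin n₁) R A₁)
    (b₂ : Module.Basis (Fin n₂) R A₂) (h₂₃ : ∀ g, d₂ (d₃ g) = 0)
    (hA' : IsAcyclicThree d₁.dualMap d₂.dualMap d₃.dualMap)
    {y : R} (s : A₂ →ₗ[R] A₃) (hs : ∀ g, s (d₃ g) = y • g) : ∃ e, d₁ e = y := by
  obtain ⟨hinj, hex₁, hex₂⟩ := hA'
  obtain ⟨t, ht⟩ := exists_comp_eq_of_dual_exact b₂ hex₂ (y • LinearMap.id - d₃ ∘ₗ s) <| by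
    ext g
    simp [hs]
  have ht' : ∀ f, t (d₂ f) = y • f - d₃ (s f) := fun f => LinearMap.congr_fun ht f
  obtain ⟨w, hw⟩ := exists_comp_eq_of_dual_exact b₁ hex₁ (y • LinearMap.id - d₂ ∘ₗ t) <| by
    ext f
    simp [ht', h₂₃]
  have hw' : ∀ e, w (d₁ e) = y • e - d₂ (t e) := fun e => LinearMap.congr_fun hw e
  have h₁₂ : ∀ f, d₁ (d₂ f) = 0 := fun f => by
    have := LinearMap.congr_fun (hex₁.apply_apply_eq_zero LinearMap.id) f
    simpa using this
  refine ⟨w 1, sub_eq_zero.1 ?_⟩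
  -- Composing the homotopy with `d₁` gives `d₁ ∘ w ∘ d₁ = y • d₁`, and injectivity of `d₁^*`
  -- cancels the right-hand `d₁`.
  have h : (d₁ (w 1) - y) • (LinearMap.id : R →ₗ[R] R) = 0 := by
    apply hinj
    rw [map_zero]
    ext e
    have h1 : d₁ (w (d₁ e)) = y * d₁ e := by rw [hw']; simp [h₁₂]
    have h2 : w (d₁ e) = d₁ e • w 1 := by rw [← map_smul, smul_eq_mul, mul_one]
    rw [h2, map_smul, smul_eq_mul] at h1
    simp only [LinearMap.dualMap_apply, LinearMap.smul_apply, LinearMap.id_apply, smul_eq_mul,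
      LinearMap.zero_apply]
    linear_combination h1
  simpa using LinearMap.congr_fun h 1

variable {C L : Submodule R A₃} (hCL : IsCompl C L)

theorem etaProj_apply_left (l : L) : etaProj hCL l = l :=
  Submodule.projectionOnto_apply_left hCL.symm l

theorem etaProj_eq_zero_iff {g : A₃} : etaProj hCL g = 0 ↔ g ∈ C :=
  Submodule.projectionOnto_apply_eq_zero_iff hCL.symm

theorem sub_etaProj_mem (g : A₃) : g - etaProj hCL g ∈ C := by
  rw [← etaProj_eq_zero_iff hCL, map_sub, etaProj_apply_left, sub_self]

theorem deltaTwo_apply (μ : DGAStructure d₃ d₂ d₁) (φ : A₁ →ₗ[R] L) (e : A₁) (f : A₂) :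
    deltaTwo μ hCL (φ, e) f = etaProj hCL (μ.mul₁₂ e f) + φ (d₂ f) :=
  rfl

theorem etaProj_mul_d₃ (μ : DGAStructure d₃ d₂ d₁) (h₃ : Function.Injective d₃)
    (h : ∀ g, d₂ (d₃ g) = 0) (e : A₁) (g : A₃) :
    etaProj hCL (μ.mul₁₂ e (d₃ g)) = d₁ e • etaProj hCL g := by
  rw [← map_smul, sub_eq_zero.1 (μ.leibniz₁₃ h₃ h e g)]

theorem isComplexFour_delta (μ : DGAStructure d₃ d₂ d₁) (h₃ : Function.Injective d₃)
    (h₂₃ : ∀ g, d₂ (d₃ g) = 0) (h₁₂ : ∀ f, d₁ (d₂ f) = 0) :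
    IsComplexFour (deltaFour d₃ C) (deltaThree μ hCL) (deltaTwo μ hCL) (deltaOne d₃ C L) := by
  have hC : ∀ (e : A₁) (c : C), etaProj hCL (μ.mul₁₂ e (d₃ c)) = 0 := fun e c => by
    rw [etaProj_mul_d₃ hCL μ h₃ h₂₃, (etaProj_eq_zero_iff hCL).2 c.2, smul_zero]
  refine ⟨?_, ?_, ?_⟩
  · refine LinearMap.ext fun c => Prod.ext (LinearMap.ext fun e => hC e c) (h₂₃ c)
  · refine LinearMap.ext fun f => LinearMap.ext fun f' => ?_
    change etaProj hCL (μ.mul₁₂ (d₂ f) f') + etaProj hCL (μ.mul₁₂ (d₂ f') f) = 0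
    rw [← map_add, μ.leibniz₂₂ h₃ h₁₂, map_zero]
  · refine LinearMap.ext fun x => LinearMap.ext fun c => ?_
    change etaProj hCL (μ.mul₁₂ x.2 (d₃ c)) + x.1 (d₂ (d₃ c)) = 0
    rw [hC, h₂₃, map_zero, add_zero]

theorem isSelfDualFour_delta (μ : DGAStructure d₃ d₂ d₁) {n₁ n₂ n : ℕ}
    (b₁ : Module.Basis (Fin n₁) R A₁) (b₂ : Module.Basis (Fin n₂) R A₂)
    (b : Module.Basis (Fin n) R C) (ε : L ≃ₗ[R] R) :
    IsSelfDualFour (hyperbolicPairing R A₁ L)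
      (deltaFour d₃ C) (deltaThree μ hCL) (deltaTwo μ hCL) (deltaOne d₃ C L) := by
  refine ⟨bijective_applyₗ_of_basis b ε, bijective_applyₗ_of_basis b₂ ε,
    bijective_hyperbolicPairing (bijective_applyₗ_of_basis b₁ ε), rfl, ?_, rfl, rfl⟩
  -- The only square that is not definitional: it expresses the symmetry of the pairing.
  refine LinearMap.ext fun f => LinearMap.ext fun x => ?_
  change etaProj hCL (μ.mul₁₂ x.2 f) + x.1 (d₂ f) = x.1 (d₂ f) + etaProj hCL (μ.mul₁₂ x.2 f)
  rw [add_comm]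

theorem exact_deltaFour_deltaThree (μ : DGAStructure d₃ d₂ d₁)
    (hA : IsAcyclicThree d₃ d₂ d₁) (h : Function.Injective d₁.dualMap) (ε : L ≃ₗ[R] R) :
    Function.Exact (deltaFour d₃ C) (deltaThree μ hCL) := by
  have h₂₃ := hA.2.1.apply_apply_eq_zero
  have hc := (isComplexFour_delta hCL μ hA.1 h₂₃ hA.2.2.apply_apply_eq_zero).1
  intro f
  refine ⟨fun hf => ?_, ?_⟩
  · obtain ⟨g, rfl⟩ := (hA.2.1 f).1 (congrArg Prod.snd hf)
    refine ⟨⟨g, (etaProj_eq_zero_iff hCL).1 (ε.map_eq_zero_iff.1 ?_)⟩, rfl⟩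
    -- `I` kills `η g`, and injectivity of `d₁^*` says that `I` has zero annihilator.
    have h1 : ε (etaProj hCL g) • (LinearMap.id : R →ₗ[R] R) = 0 := by
      apply h
      rw [map_zero]
      ext e
      have h2 : etaProj hCL (μ.mul₁₂ e (d₃ g)) = 0 :=
        LinearMap.congr_fun (congrArg Prod.fst hf) e
      rw [etaProj_mul_d₃ hCL μ hA.1 h₂₃] at h2
      have h3 := congrArg ε h2
      rw [map_smul, map_zero, smul_eq_mul, mul_comm] at h3
      exact h3
    simpa using LinearMap.congr_fun h1 1
  · rintro ⟨c, rfl⟩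
    exact LinearMap.congr_fun hc c

theorem exact_deltaThree_deltaTwo (μ : DGAStructure d₃ d₂ d₁)
    (hA : IsAcyclicThree d₃ d₂ d₁) (h : Function.Exact d₁.dualMap d₂.dualMap) (ε : L ≃ₗ[R] R) :
    Function.Exact (deltaThree μ hCL) (deltaTwo μ hCL) := by
  have h₂₃ := hA.2.1.apply_apply_eq_zero
  have hc := (isComplexFour_delta hCL μ hA.1 h₂₃ hA.2.2.apply_apply_eq_zero).2.1
  rintro ⟨φ, e⟩
  refine ⟨fun hf => ?_, ?_⟩
  · have he : d₁ e = 0 := by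
      -- Evaluating at `d₃` of the generator of `L` isolates `d₁ e`.
      have h1 := LinearMap.congr_fun hf (d₃ (ε.symm 1))
      rw [deltaTwo_apply, etaProj_mul_d₃ hCL μ hA.1 h₂₃, h₂₃, etaProj_apply_left] at h1
      have h2 := congrArg ε h1
      simpa using h2
    obtain ⟨f, rfl⟩ := (hA.2.2 e).1 he
    have h0 : ∀ f', φ (d₂ f') = etaProj hCL (μ.mul₁₂ (d₂ f') f) := fun f' => by
      have h1 : etaProj hCL (μ.mul₁₂ (d₂ f) f') + φ (d₂ f') = 0 := LinearMap.congr_fun hf f'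
      have h2 := congrArg (etaProj hCL)
        (μ.leibniz₂₂ hA.1 hA.2.2.apply_apply_eq_zero f f')
      rw [map_add, map_zero] at h2
      exact add_left_cancel (h1.trans h2.symm)
    obtain ⟨w, hw⟩ := (h (ε.toLinearMap ∘ₗ
      (φ - (μ.mul₁₂.compr₂ (etaProj hCL)).flip f))).1 <| by
        ext f'
        simp [h0]
    -- `φ - η(- · f)` vanishes on the image of `d₂`, so it is `w ∘ d₁` up to `ε`; adding an element
    -- of `d₃ L` absorbs it without changing `d₂ f`.
    refine ⟨f + d₃ (ε.symm (w 1)), ?_⟩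
    refine Prod.ext (LinearMap.ext fun e => ?_) ?_
    · change etaProj hCL (μ.mul₁₂ e (f + d₃ (ε.symm (w 1)))) = φ e
      have h1 : w (d₁ e) = ε (φ e - etaProj hCL (μ.mul₁₂ e f)) := LinearMap.congr_fun hw e
      have h2 : w (d₁ e) = d₁ e • w 1 := by rw [← map_smul, smul_eq_mul, mul_one]
      rw [map_add, map_add, etaProj_mul_d₃ hCL μ hA.1 h₂₃, etaProj_apply_left, ← map_smul,
        ← h2, h1, LinearEquiv.symm_apply_apply, add_sub_cancel]
    · change d₂ (f + d₃ (ε.symm (w 1))) = d₂ f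
      rw [map_add, h₂₃, add_zero]
  · rintro ⟨f, hf⟩
    rw [← hf]
    exact LinearMap.congr_fun hc f

/-- The annihilation behind exactness at `Hom(A₂, L)`: if `ψ` restricts on `A₃` to `x` times the
projection to `L`, then the maximal minors of `d₃|_C` multiply `x` into the image of `d₁`. -/
theorem smul_mem_range_of_mem_minorsIdeal {n₁ n₂ n : ℕ} (b₁ : Module.Basis (Fin n₁) R A₁)
    (b₂ : Module.Basis (Fin n₂) R A₂) (b : Module.Basis (Fin n) R C)
    (h₂₃ : ∀ g, d₂ (d₃ g) = 0)
    (hA' : IsAcyclicThree d₁.dualMap d₂.dualMap d₃.dualMap)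
    {x : R} (ψ : A₂ →ₗ[R] L) (hψ : ∀ g, ψ (d₃ g) = x • etaProj hCL g)
    {a : R} (ha : a ∈ minorsIdeal n (deltaFour d₃ C)) : a • x ∈ LinearMap.range d₁ := by
  obtain ⟨σ, hσ⟩ := exists_comp_eq_smul_of_mem_minorsIdeal b _ ha
  have hσ' : ∀ c : C, σ (d₃ c) = a • c := fun c => LinearMap.congr_fun hσ c
  -- After `d₃`, the first term is `a x` on `C` and the second is `a x` on `L`; the third cancels
  -- the stray `x • σ ∘ d₃` on `L`.
  refine exists_eq_of_comp_eq_smul b₁ b₂ h₂₃ hA'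
    (x • C.subtype ∘ₗ σ + a • L.subtype ∘ₗ ψ - C.subtype ∘ₗ σ ∘ₗ d₃ ∘ₗ L.subtype ∘ₗ ψ)
    fun g => ?_
  have h1 : σ (d₃ g) = a • ⟨g - etaProj hCL g, sub_etaProj_mem hCL g⟩ +
      σ (d₃ (etaProj hCL g)) := by
    rw [← hσ', ← map_add, ← map_add, sub_add_cancel]
  simp only [LinearMap.sub_apply, LinearMap.add_apply, LinearMap.smul_apply,
    LinearMap.comp_apply, hψ, h1, map_add, map_smul, Submodule.subtype_apply]
  module

/-- `ψ ∘ d₃` kills `C`, so it factors through `η`, and an endomorphism of `L ≅ R` is a scalar. -/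
theorem exists_apply_d₃_eq_smul_etaProj (ε : L ≃ₗ[R] R) (ψ : A₂ →ₗ[R] L)
    (hψ : deltaOne d₃ C L ψ = 0) : ∃ x : R, ∀ g, ψ (d₃ g) = x • etaProj hCL g := by
  refine ⟨ε (ψ (d₃ (ε.symm 1))), fun g => ?_⟩
  have h1 : ψ (d₃ (g - etaProj hCL g)) = 0 :=
    LinearMap.congr_fun hψ ⟨g - etaProj hCL g, sub_etaProj_mem hCL g⟩
  have h2 : etaProj hCL g = ε (etaProj hCL g) • ε.symm 1 := by
    rw [← map_smul, smul_eq_mul, mul_one, LinearEquiv.symm_apply_apply]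
  rw [map_sub, map_sub, sub_eq_zero] at h1
  apply ε.injective
  rw [h1]
  conv_lhs => rw [h2]
  rw [Submodule.coe_smul, map_smul, map_smul, map_smul, map_smul, smul_eq_mul, smul_eq_mul,
    mul_comm]

end Construction

/-! ### Torsion-freeness of cokernels, acyclicity and the grade dichotomy. -/

section Acyclicity

variable {R : Type u} [CommRing R] {A₁ A₂ A₃ : Type*}
  [AddCommGroup A₁] [Module R A₁] [AddCommGroup A₂] [Module R A₂]
  [AddCommGroup A₃] [Module R A₃]
  {d₃ : A₃ →ₗ[R] A₂} {d₂ : A₂ →ₗ[R] A₁} {d₁ : A₁ →ₗ[R] R}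

/-- The cokernel of a free resolution of length three has no `J`-torsion if `grade J ≥ 4`. -/
theorem IsAcyclicThree.mem_range_of_forall_smul_mem
    {F₀ F₁ F₂ F₃ : Type*} [AddCommGroup F₀] [Module R F₀] [AddCommGroup F₁] [Module R F₁]
    [AddCommGroup F₂] [Module R F₂] [AddCommGroup F₃] [Module R F₃]
    [Module.Free R F₀] [Module.Finite R F₀] [Module.Free R F₁] [Module.Finite R F₁]
    [Module.Free R F₂] [Module.Finite R F₂] [Module.Free R F₃] [Module.Finite R F₃]
    {d₃ : F₃ →ₗ[R] F₂} {d₂ : F₂ →ₗ[R] F₁} {d₁ : F₁ →ₗ[R] F₀} (hF : IsAcyclicThree d₃ d₂ d₁)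
    {J : Ideal R} (hJ : 4 ≤ idealGrade J) {x : F₀} (hx : ∀ a ∈ J, a • x ∈ LinearMap.range d₁) :
    x ∈ LinearMap.range d₁ := by
  have hJ' : ((4 : ℕ) : ℕ∞) ≤ idealGrade J := hJ
  -- Each syzygy costs one: the bounds 4, 3, 2 end at the 2 needed for torsion-freeness.
  have h₃ : ExtVanishesBelow J 4 (LinearMap.range d₃) :=
    (extVanishesBelow_of_free hJ').range_of_injective hF.1
  have h₂ : ExtVanishesBelow J 3 (LinearMap.range d₂) :=
    h₃.range_of_exact ((extVanishesBelow_of_free hJ').mono (by norm_num))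
      (LinearMap.exact_iff.1 hF.2.1)
  have h₁ : ExtVanishesBelow J 2 (LinearMap.range d₁) :=
    h₂.range_of_exact ((extVanishesBelow_of_free hJ').mono (by norm_num))
      (LinearMap.exact_iff.1 hF.2.2)
  exact h₁.mem_of_forall_smul_mem ((extVanishesBelow_of_free hJ').mono (by norm_num)) hx

/-- The cokernel of a free resolution of length four has no `J`-torsion if `grade J ≥ 5`. -/
theorem IsAcyclicFour.mem_range_of_forall_smul_mem
    {F₀ F₁ F₂ F₃ F₄ : Type*} [AddCommGroup F₀] [Module R F₀] [AddCommGroup F₁] [Module R F₁]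
    [AddCommGroup F₂] [Module R F₂] [AddCommGroup F₃] [Module R F₃]
    [AddCommGroup F₄] [Module R F₄]
    [Module.Free R F₀] [Module.Finite R F₀] [Module.Free R F₁] [Module.Finite R F₁]
    [Module.Free R F₂] [Module.Finite R F₂] [Module.Free R F₃] [Module.Finite R F₃]
    [Module.Free R F₄] [Module.Finite R F₄]
    {d₄ : F₄ →ₗ[R] F₃} {d₃ : F₃ →ₗ[R] F₂} {d₂ : F₂ →ₗ[R] F₁} {d₁ : F₁ →ₗ[R] F₀}
    (hF : IsAcyclicFour d₄ d₃ d₂ d₁)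
    {J : Ideal R} (hJ : 5 ≤ idealGrade J) {x : F₀} (hx : ∀ a ∈ J, a • x ∈ LinearMap.range d₁) :
    x ∈ LinearMap.range d₁ := by
  have hJ' : ((5 : ℕ) : ℕ∞) ≤ idealGrade J := hJ
  have h₄ : ExtVanishesBelow J 5 (LinearMap.range d₄) :=
    (extVanishesBelow_of_free hJ').range_of_injective hF.1
  have h₃ : ExtVanishesBelow J 4 (LinearMap.range d₃) :=
    h₄.range_of_exact ((extVanishesBelow_of_free hJ').mono (by norm_num))
      (LinearMap.exact_iff.1 hF.2.1)
  have h₂ : ExtVanishesBelow J 3 (LinearMap.range d₂) :=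
    h₃.range_of_exact ((extVanishesBelow_of_free hJ').mono (by norm_num))
      (LinearMap.exact_iff.1 hF.2.2.1)
  have h₁ : ExtVanishesBelow J 2 (LinearMap.range d₁) :=
    h₂.range_of_exact ((extVanishesBelow_of_free hJ').mono (by norm_num))
      (LinearMap.exact_iff.1 hF.2.2.2)
  exact h₁.mem_of_forall_smul_mem ((extVanishesBelow_of_free hJ').mono (by norm_num)) hx

variable {C L : Submodule R A₃} (hCL : IsCompl C L)

theorem exact_deltaTwo_deltaOne (μ : DGAStructure d₃ d₂ d₁)
    {n₁ n₂ n₃ n : ℕ} (b₁ : Module.Basis (Fin n₁) R A₁)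
    (b₂ : Module.Basis (Fin n₂) R A₂) (b₃ : Module.Basis (Fin n₃) R A₃)
    (b : Module.Basis (Fin n) R C) (ε : L ≃ₗ[R] R)
    (hA : IsAcyclicThree d₃ d₂ d₁) (hA' : IsAcyclicThree d₁.dualMap d₂.dualMap d₃.dualMap)
    (hJ : 4 ≤ idealGrade (minorsIdeal n (deltaFour d₃ C))) :
    Function.Exact (deltaTwo μ hCL) (deltaOne d₃ C L) := by
  have := Module.Free.of_basis b₁
  have := Module.Finite.of_basis b₁
  have := Module.Free.of_basis b₂
  have := Module.Finite.of_basis b₂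
  have := Module.Free.of_basis b₃
  have := Module.Finite.of_basis b₃
  have h₂₃ := hA.2.1.apply_apply_eq_zero
  have hc := (isComplexFour_delta hCL μ hA.1 h₂₃ hA.2.2.apply_apply_eq_zero).2.2
  intro ψ
  refine ⟨fun hψ => ?_, ?_⟩
  · obtain ⟨x, hx⟩ := exists_apply_d₃_eq_smul_etaProj hCL ε ψ hψ
    obtain ⟨e, rfl⟩ := hA.mem_range_of_forall_smul_mem hJ fun a ha =>
      smul_mem_range_of_mem_minorsIdeal hCL b₁ b₂ b h₂₃ hA' ψ hx ha
    obtain ⟨φ, hφ⟩ := exists_comp_eq_of_dual_exact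
      ((Module.Basis.singleton (Fin 1) R).map ε.symm) hA'.2.2
      (ψ - etaProj hCL ∘ₗ μ.mul₁₂ e) <| by
        refine LinearMap.ext fun g => ?_
        change ψ (d₃ g) - etaProj hCL (μ.mul₁₂ e (d₃ g)) = 0
        rw [hx, etaProj_mul_d₃ hCL μ hA.1 h₂₃, sub_self]
    refine ⟨(φ, e), LinearMap.ext fun f => ?_⟩
    have h1 : φ (d₂ f) = ψ f - etaProj hCL (μ.mul₁₂ e f) := LinearMap.congr_fun hφ f
    rw [deltaTwo_apply, h1, add_sub_cancel]
  · rintro ⟨x, rfl⟩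
    exact LinearMap.congr_fun hc x

theorem isAcyclicFour_delta (μ : DGAStructure d₃ d₂ d₁)
    {n₁ n₂ n₃ n : ℕ} (b₁ : Module.Basis (Fin n₁) R A₁)
    (b₂ : Module.Basis (Fin n₂) R A₂) (b₃ : Module.Basis (Fin n₃) R A₃)
    (b : Module.Basis (Fin n) R C) (ε : L ≃ₗ[R] R)
    (hA : IsAcyclicThree d₃ d₂ d₁) (hA' : IsAcyclicThree d₁.dualMap d₂.dualMap d₃.dualMap)
    (hJ : 4 ≤ idealGrade (minorsIdeal n (deltaFour d₃ C))) :
    IsAcyclicFour (deltaFour d₃ C) (deltaThree μ hCL) (deltaTwo μ hCL) (deltaOne d₃ C L) :=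
  ⟨hA.1.comp C.injective_subtype, exact_deltaFour_deltaThree hCL μ hA hA'.1 ε,
    exact_deltaThree_deltaTwo hCL μ hA hA'.2.1 ε,
    exact_deltaTwo_deltaOne hCL μ b₁ b₂ b₃ b ε hA hA' hJ⟩

/-- Lifts of the coordinate functionals assemble to a left inverse of `φ`. -/
theorem minorsIdeal_eq_top_of_surjective_twistedDual {M N L : Type*} [AddCommGroup M] [Module R M]
    [AddCommGroup N] [Module R N] [AddCommGroup L] [Module R L] (ε : L ≃ₗ[R] R)
    {n : ℕ} (b : Module.Basis (Fin n) R M) (φ : M →ₗ[R] N)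
    (h : Function.Surjective (twistedDual L φ)) : minorsIdeal n φ = ⊤ := by
  choose t ht using fun i => h (ε.symm.toLinearMap ∘ₗ b.coord i)
  have ht' : ∀ i x, ε (t i (φ x)) = b.repr x i := fun i x => by
    have h1 : t i (φ x) = ε.symm (b.repr x i) := LinearMap.congr_fun (ht i) x
    rw [h1, LinearEquiv.apply_symm_apply]
  refine minorsIdeal_eq_top_of_comp_eq_id b φ
    (∑ i, (ε.toLinearMap ∘ₗ t i).smulRight (b i)) ?_
  ext x
  simp [ht', b.sum_repr]

/-- The maximal minors of `φ : M → N` annihilate the cokernel of its twisted dual. -/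
theorem smul_mem_range_twistedDual {M N L : Type*} [AddCommGroup M] [Module R M]
    [AddCommGroup N] [Module R N] [AddCommGroup L] [Module R L]
    {n : ℕ} (b : Module.Basis (Fin n) R M) (φ : M →ₗ[R] N)
    {a : R} (ha : a ∈ minorsIdeal n φ) (χ : M →ₗ[R] L) :
    a • χ ∈ LinearMap.range (twistedDual L φ) := by
  obtain ⟨σ, hσ⟩ := exists_comp_eq_smul_of_mem_minorsIdeal b φ ha
  refine ⟨χ ∘ₗ σ, ?_⟩
  change (χ ∘ₗ σ) ∘ₗ φ = a • χ
  rw [LinearMap.comp_assoc, hσ, LinearMap.comp_smul, LinearMap.comp_id]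

end Acyclicity

theorem mainTheorem1 {R : Type u} [CommRing R] [IsNoetherianRing R]
    (p q : ℕ) (hp : 1 ≤ p) (hq : 3 ≤ q)
    {A₁ A₂ A₃ : Type v}
    [AddCommGroup A₁] [Module R A₁] [AddCommGroup A₂] [Module R A₂]
    [AddCommGroup A₃] [Module R A₃]
    (hA₁ : IsFreeOfRank R A₁ (p + 2)) (hA₂ : IsFreeOfRank R A₂ (p + q))
    (hA₃ : IsFreeOfRank R A₃ (q - 1))
    (d₃ : A₃ →ₗ[R] A₂) (d₂ : A₂ →ₗ[R] A₁) (d₁ : A₁ →ₗ[R] R)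
    (hA : IsAcyclicThree d₃ d₂ d₁)
    (hA' : IsAcyclicThree d₁.dualMap d₂.dualMap d₃.dualMap)
    (μ : DGAStructure d₃ d₂ d₁)
    (C L : Submodule R A₃) (hCL : IsCompl C L)
    (hC : IsFreeOfRank R C (q - 2)) (hL : IsFreeOfRank R L 1) :
    IsComplexFour (deltaFour d₃ C) (deltaThree μ hCL) (deltaTwo μ hCL) (deltaOne d₃ C L) ∧
    IsSelfDualFour (hyperbolicPairing R A₁ L)
      (deltaFour d₃ C) (deltaThree μ hCL) (deltaTwo μ hCL) (deltaOne d₃ C L) ∧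
    (4 ≤ idealGrade (minorsIdeal (q - 2) (deltaFour d₃ C)) →
      IsAcyclicFour (deltaFour d₃ C) (deltaThree μ hCL) (deltaTwo μ hCL) (deltaOne d₃ C L) ∧
      (idealGrade (minorsIdeal (q - 2) (deltaFour d₃ C)) = 4 ∨
        minorsIdeal (q - 2) (deltaFour d₃ C) = ⊤)) := by
  obtain ⟨b₁⟩ := hA₁
  obtain ⟨b₂⟩ := hA₂
  obtain ⟨b₃⟩ := hA₃
  obtain ⟨b⟩ := hC
  obtain ⟨bL⟩ := hL
  have ε : L ≃ₗ[R] R := bL.equivFun.trans (LinearEquiv.funUnique (Fin 1) R R)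
  have := Module.Free.of_basis b₁
  have := Module.Finite.of_basis b₁
  have := Module.Free.of_basis b₂
  have := Module.Finite.of_basis b₂
  have := Module.Free.of_basis b
  have := Module.Finite.of_basis b
  have := Module.Free.of_basis bL
  have := Module.Finite.of_basis bL
  refine ⟨isComplexFour_delta hCL μ hA.1 hA.2.1.apply_apply_eq_zero
    hA.2.2.apply_apply_eq_zero, isSelfDualFour_delta hCL μ b₁ b₂ b ε, fun hJ => ?_⟩
  have hB := isAcyclicFour_delta hCL μ b₁ b₂ b₃ b ε hA hA' hJ
  refine ⟨hB, hJ.eq_or_lt.imp Eq.symm fun h => ?_⟩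
  have h5 : 5 ≤ idealGrade (minorsIdeal (q - 2) (deltaFour d₃ C)) := by
    have := Order.add_one_le_of_lt h
    norm_num at this
    exact this
  -- Coker `δ₁` is killed by `J` and has no `J`-torsion, hence is zero.
  exact minorsIdeal_eq_top_of_surjective_twistedDual ε b _ fun χ =>
    hB.mem_range_of_forall_smul_mem h5 fun a ha => smul_mem_range_twistedDual b _ ha χ
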